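/- **Theorem (Preconditioned tail-averaged randomized Kaczmarz with volume sampling).** Let $A\in\mathbb R^{n\times d}$ have rank $r\ge 1$, let $b\in\mathbb R^n$, and let $x_\star=A^+b$, where ${}^+$ denotes the Moore–Penrose pseudoinverse and $\|\cdot\|$ the Euclidean norm. Let $0\le t_{\rm b}<t$ be integers, and consider the following algorithm. 1. Take any thin QR decomposition $A=QR$, i.e. $Q\in\mathbb R^{n\times r}$ has orthonormal columns and $R\in\mathbb R^{r\times d}$ is upper triangular (upper trapezoidal). 2. Sample an $r$-element subset $S\subseteq\{1,\dots,n\}$ from the square-volume distribution $$\mathbb P(S)=\frac{\det(Q(S,:))^2}{\sum_{|S'|=r}\det(Q(S',:))^2}.$$ 3. Set $y_0=Q_S^{-1}b_S$, where $Q_S=Q(S,:)$, and, writing $q_i^\top$ for the $i$-th row of $Q$, for $s=0,\dots,t-2$ sample a row index $i_s$ (independently of $S$ and of the other indices) with $\mathbb P\{i_s=i\}=\|q_i\|^2/\|Q\|_{\rm F}^2$ and put $$y_{s+1}=y_s+\frac{b_{i_s}-q_{i_s}^\top y_s}{\|q_{i_s}\|^2}\,q_{i_s}.$$ Let $\overline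 y_t=\frac1{t-t_{\rm b}}\sum_{s=t_{\rm b}}^{t-1}y_s$. 4. Return $\hat x=R^+\,\overline y_t$. Then, for all integers $0\le t_{\rm b}<t$, $$\mathbb E\,\|b-A\hat x\|^2\le\Bigl[1+\Bigl(1-\frac1r\Bigr)^{t_{\rm b}}r+\frac{2r-1}{t-t_{\rm b}}\Bigr]\,\|b-Ax_\star\|^2$$ (with $0^0=1$). In particular, let $0<\varepsilon\le 2r$ and set $t_{\rm b}=\lceil r\log(2r/\varepsilon)\rceil$ and $t=t_{\rm b}+\lceil(4r-2)/\varepsilon\rceil$. Then the algorithm achieves $$\mathbb E\,\|b-A\hat x\|^2\le(1+\varepsilon)\,\|b-Ax_\star\|^2,$$ and it evaluates at most $$\Bigl\lceil r+r\log\Bigl(\frac{2r}{\varepsilon}\Bigr)+\frac{4r-2}{\varepsilon}\Bigr\rceil$$ entries of $b$, counted with multiplicity: the $r$ entries indexed by $S$ and the $t-1$ entries $b_{i_0},\dots,b_{i_{t-2}}$. For every outcome of the random choices, the output depends on $b$ only through these entries. -/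

import Mathlib

open MeasureTheory ProbabilityTheory
open scoped Matrix

noncomputable section

/-- `X` is a Moore–Penrose pseudoinverse of the real matrix `A` (the four Penrose equations). -/
structure IsMoorePenrose {m n : ℕ} (A : Matrix (Fin m) (Fin n) ℝ)
    (X : Matrix (Fin n) (Fin m) ℝ) : Prop where
  mul_mul_self : A * X * A = A
  self_mul_mul : X * A * X = X
  symm_left : (A * X)ᵀ = A * X
  symm_right : (X * A)ᵀ = X * A

theorem exists_isMoorePenrose {m n : ℕ} (A : Matrix (Fin m) (Fin n) ℝ) :
    ∃ X, IsMoorePenrose A X := by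
  have hH : (Aᵀ * A).IsHermitian := by
    simpa [Matrix.conjTranspose_eq_transpose_of_trivial] using
      Matrix.isHermitian_conjTranspose_mul_self A
  obtain ⟨G, hGs, h1, h2, h3⟩ : ∃ G : Matrix (Fin n) (Fin n) ℝ, Gᵀ = G ∧
      G * (Aᵀ * A) * G = G ∧ (G * (Aᵀ * A))ᵀ = G * (Aᵀ * A) ∧
      (Aᵀ * A) * (G * (Aᵀ * A)) = Aᵀ * A := by
    set U : Matrix (Fin n) (Fin n) ℝ := (hH.eigenvectorUnitary : Matrix (Fin n) (Fin n) ℝ)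
    have hU : Uᵀ * U = 1 := by
      have := Unitary.coe_star_mul_self hH.eigenvectorUnitary
      simpa [Matrix.star_eq_conjTranspose, Matrix.conjTranspose_eq_transpose_of_trivial] using this
    set D : Matrix (Fin n) (Fin n) ℝ := Matrix.diagonal hH.eigenvalues with hD
    set E : Matrix (Fin n) (Fin n) ℝ := Matrix.diagonal (fun k => (hH.eigenvalues k)⁻¹) with hE
    have hs : Aᵀ * A = U * D * Uᵀ := by
      have := hH.spectral_theorem
      rw [Unitary.conjStarAlgAut_apply] at this
      simpa [Matrix.star_eq_conjTranspose, Matrix.conjTranspose_eq_transpose_of_trivial,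
        Function.comp_def] using this
    have hEDE : E * D * E = E := by
      simp only [hD, hE, Matrix.diagonal_mul_diagonal]
      congr 1; funext k
      by_cases h : hH.eigenvalues k = 0 <;> simp [h]
    have hDED : D * (E * D) = D := by
      simp only [hD, hE, Matrix.diagonal_mul_diagonal]
      congr 1; funext k
      by_cases h : hH.eigenvalues k = 0 <;> simp [h]
    have key : U * E * Uᵀ * (U * D * Uᵀ) = U * (E * D) * Uᵀ := by
      calc _ = U * E * (Uᵀ * U) * D * Uᵀ := by simp only [Matrix.mul_assoc]
        _ = _ := by rw [hU, Matrix.mul_one]; simp only [Matrix.mul_assoc]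
    refine ⟨U * E * Uᵀ, ?_, ?_, ?_, ?_⟩
    · simp [hE, Matrix.transpose_mul, Matrix.mul_assoc]
    · rw [hs, key]
      calc _ = U * (E * D) * (Uᵀ * U) * E * Uᵀ := by simp only [Matrix.mul_assoc]
        _ = U * (E * D * E) * Uᵀ := by rw [hU, Matrix.mul_one]; simp only [Matrix.mul_assoc]
        _ = _ := by rw [hEDE]
    · rw [hs, key]
      simp [hD, hE, Matrix.transpose_mul, Matrix.mul_assoc]
    · rw [hs, key]
      calc _ = U * D * (Uᵀ * U) * (E * D) * Uᵀ := by simp only [Matrix.mul_assoc]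
        _ = U * (D * (E * D)) * Uᵀ := by rw [hU, Matrix.mul_one]; simp only [Matrix.mul_assoc]
        _ = _ := by rw [hDED]
  refine ⟨G * Aᵀ, ⟨?_, ?_, ?_, ?_⟩⟩
  · have h0 : Aᵀ * A * (G * (Aᵀ * A) - 1) = 0 := by
      rw [Matrix.mul_sub, h3, Matrix.mul_one, sub_self]
    have h4 : A * (G * (Aᵀ * A) - 1) = 0 := by
      rw [← Matrix.conjTranspose_eq_transpose_of_trivial A] at h0 ⊢
      exact (Matrix.conjTranspose_mul_self_mul_eq_zero A _).1 h0
    rw [Matrix.mul_sub, Matrix.mul_one, sub_eq_zero] at h4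
    simpa only [Matrix.mul_assoc] using h4
  · have := congrArg (· * Aᵀ) h1
    simpa only [Matrix.mul_assoc] using this
  · simp [Matrix.transpose_mul, hGs, Matrix.mul_assoc]
  · simpa only [Matrix.mul_assoc] using h2

theorem IsMoorePenrose.unique {m n : ℕ} {A : Matrix (Fin m) (Fin n) ℝ}
    {X Y : Matrix (Fin n) (Fin m) ℝ} (hX : IsMoorePenrose A X) (hY : IsMoorePenrose A Y) :
    X = Y := by
  have e1 : A * X = A * Y := by
    calc A * X = (A * X)ᵀ := hX.symm_left.symm
      _ = (A * Y * A * X)ᵀ := by rw [hY.mul_mul_self]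
      _ = (A * X)ᵀ * (A * Y)ᵀ := by rw [← Matrix.transpose_mul]; simp only [Matrix.mul_assoc]
      _ = A * X * (A * Y) := by rw [hX.symm_left, hY.symm_left]
      _ = A * X * A * Y := by simp only [Matrix.mul_assoc]
      _ = A * Y := by rw [hX.mul_mul_self]
  have e2 : X * A = Y * A := by
    calc X * A = (X * A)ᵀ := hX.symm_right.symm
      _ = (X * (A * Y * A))ᵀ := by rw [hY.mul_mul_self]
      _ = (Y * A)ᵀ * (X * A)ᵀ := by rw [← Matrix.transpose_mul]; simp only [Matrix.mul_assoc]
      _ = Y * A * (X * A) := by rw [hX.symm_right, hY.symm_right]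
      _ = Y * (A * X * A) := by simp only [Matrix.mul_assoc]
      _ = Y * A := by rw [hX.mul_mul_self]
  calc X = X * A * X := hX.self_mul_mul.symm
    _ = Y * (A * X) := by rw [e2, Matrix.mul_assoc]
    _ = Y * A * Y := by rw [e1, Matrix.mul_assoc]
    _ = Y := hY.self_mul_mul

/-- The Moore–Penrose pseudoinverse `A⁺` of a real matrix. -/
def pinv {m n : ℕ} (A : Matrix (Fin m) (Fin n) ℝ) : Matrix (Fin n) (Fin m) ℝ :=
  (exists_isMoorePenrose A).choose

theorem isMoorePenrose_pinv {m n : ℕ} (A : Matrix (Fin m) (Fin n) ℝ) :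
    IsMoorePenrose A (pinv A) :=
  (exists_isMoorePenrose A).choose_spec

/-- The squared Euclidean residual norm `‖b - A x‖²`. -/
def residualSq {n d : ℕ} (A : Matrix (Fin n) (Fin d) ℝ) (b : Fin n → ℝ) (x : Fin d → ℝ) : ℝ :=
  ‖WithLp.toLp 2 (b - A *ᵥ x)‖ ^ 2

/-- A thin QR decomposition of a matrix whose rank may be smaller than its number of columns:
`A = Q R`, where `Q` has `r` orthonormal columns and `R` is `r × d` upper triangular
(upper trapezoidal). -/
structure IsThinQR {n d r : ℕ} (A : Matrix (Fin n) (Fin d) ℝ)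
    (Q : Matrix (Fin n) (Fin r) ℝ) (R : Matrix (Fin r) (Fin d) ℝ) : Prop where
  eq_mul : A = Q * R
  orthonormal : Qᵀ * Q = 1
  upper : ∀ (i : Fin r) (j : Fin d), (j : ℕ) < (i : ℕ) → R i j = 0

/-- The `r`-element subsets of the set of row indices. -/
abbrev RowSubset (n r : ℕ) : Type := {S : Finset (Fin n) // S.card = r}

/-- The square submatrix `Q(S, :)`, with the rows in increasing order. -/
def rowSubmatrix {n r : ℕ} (Q : Matrix (Fin n) (Fin r) ℝ) (S : RowSubset n r) :
    Matrix (Fin r) (Fin r) ℝ :=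
  Q.submatrix (S.1.orderEmbOfFin S.2) id

/-- The probability of `S` under the square-volume distribution. -/
def volumeProb {n r : ℕ} (Q : Matrix (Fin n) (Fin r) ℝ) (S : RowSubset n r) : ℝ :=
  (rowSubmatrix Q S).det ^ 2 / ∑ S' : RowSubset n r, (rowSubmatrix Q S').det ^ 2

/-- The squared Euclidean norm of the `i`-th row of `A`. -/
def rowNormSq {n d : ℕ} (A : Matrix (Fin n) (Fin d) ℝ) (i : Fin n) : ℝ :=
  ∑ j, A i j ^ 2

/-- The Kaczmarz row-sampling probability `‖aᵢ‖² / ‖A‖_F²`. -/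
def rowProb {n d : ℕ} (A : Matrix (Fin n) (Fin d) ℝ) (i : Fin n) : ℝ :=
  rowNormSq A i / ∑ k, rowNormSq A k

/-- One Kaczmarz update with row `i`:  `x + (bᵢ - aᵢᵀ x) / ‖aᵢ‖² • aᵢ`.
(If the row vanishes, which has probability zero, the update does nothing.) -/
def rkStep {n d : ℕ} (A : Matrix (Fin n) (Fin d) ℝ) (b : Fin n → ℝ) (x : Fin d → ℝ)
    (i : Fin n) : Fin d → ℝ :=
  x + ((b i - A i ⬝ᵥ x) / rowNormSq A i) • A i

/-- The Kaczmarz iterates `x₀, x₁, …`, where step `s` uses the row index `i s`. -/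
def rkIterate {n d : ℕ} (A : Matrix (Fin n) (Fin d) ℝ) (b : Fin n → ℝ) (x₀ : Fin d → ℝ)
    (i : ℕ → Fin n) : ℕ → Fin d → ℝ
  | 0 => x₀
  | s + 1 => rkStep A b (rkIterate A b x₀ i s) (i s)

/-- Tail-averaged randomized Kaczmarz, with burn-in time `tb` and final time `t`: the average of
the iterates `x_s`, `tb ≤ s ≤ t - 1`, as a function of the sampled row indices. -/
def tark {n d : ℕ} (A : Matrix (Fin n) (Fin d) ℝ) (b : Fin n → ℝ) (x₀ : Fin d → ℝ)
    (tb t : ℕ) (i : ℕ → Fin n) : Fin d → ℝ :=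
  ((t : ℝ) - (tb : ℝ))⁻¹ • ∑ s ∈ Finset.Ico tb t, rkIterate A b x₀ i s

/-- The initial estimate `y₀ = Q_S⁻¹ b_S`. -/
def volumeInit {n r : ℕ} (Q : Matrix (Fin n) (Fin r) ℝ) (b : Fin n → ℝ) (S : RowSubset n r) :
    Fin r → ℝ :=
  (rowSubmatrix Q S)⁻¹ *ᵥ fun k => b (S.1.orderEmbOfFin S.2 k)

/-- The output `x̂ = R⁺ ȳ_t` of preconditioned tail-averaged randomized Kaczmarz for the sampled
row subset `S` and the sampled row indices `i 0, i 1, …`. -/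
def precondTark {n d r : ℕ} (Q : Matrix (Fin n) (Fin r) ℝ) (R : Matrix (Fin r) (Fin d) ℝ)
    (b : Fin n → ℝ) (tb t : ℕ) (S : RowSubset n r) (i : ℕ → Fin n) : Fin d → ℝ :=
  pinv R *ᵥ tark Q b (volumeInit Q b S) tb t i

/-- The positions of the entries of `b` which the algorithm with final time `t` evaluates, with
multiplicity: the rows in `S` for the initialization, then one row for each of the `t - 1`
Kaczmarz updates (those with index `0, …, t - 2`). -/
def entriesRead {n r : ℕ} (t : ℕ) (S : RowSubset n r) (i : ℕ → Fin n) : Multiset (Fin n) :=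
  S.1.val + (Multiset.range (t - 1)).map i

/-- The random choices of the algorithm: `S` has the square-volume distribution of `Q`, the row
indices `i 0, i 1, …` are independent with the Kaczmarz row-sampling distribution of `Q`, and `S`
is independent of the sequence of row indices. -/
structure IsPrecondTarkSample {n r : ℕ} (Q : Matrix (Fin n) (Fin r) ℝ) {Ω : Type*}
    [MeasurableSpace Ω] (μ : Measure Ω) (S : Ω → RowSubset n r) (i : ℕ → Ω → Fin n) : Prop where
  measurable_subset : Measurable S
  measurable_index : ∀ s, Measurable (i s)
  subset_law : ∀ T, μ.real (S ⁻¹' {T}) = volumeProb Q T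
  index_law : ∀ s k, μ.real (i s ⁻¹' {k}) = rowProb Q k
  index_indep : iIndepFun i μ
  subset_indep : IndepFun S (fun ω s => i s ω) μ

end

/-!
Write `c = Qᵀ b` and `e = b - Q c`, so that `Qᵀ e = 0`. Since `A` has rank `r`, the factor `R` has
full row rank and `R R⁺ = 1`; moreover `A A⁺ = Q Qᵀ`. By Pythagoras, the residual of `R⁺ y` is
`‖e‖² + ‖y - c‖²`, with `‖e‖²` the optimal residual (`IsThinQR.residualSq_pinv_mulVec`). It
remains to bound the mean squared error of the tail average as an estimate of `c`.

*Initialization.* The error of `Q_S⁻¹ b_S` is `Q_S⁻¹ e_S`. By Cramer's rule its squared norm, weighted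
by `det(Q_S)²`, is a sum over `j` of squared minors of `Q` with column `j` replaced by `e`. By the
Cauchy–Binet formula (`det_transpose_mul_self_eq_sum`) these sum over `S` to a Gram determinant equal
to `‖e‖²`, so the expected initial squared error is at most `r ‖e‖²`
(`sum_volumeProb_mul_volumeInit_le`).

*Iteration.* The errors `z_s` are themselves Kaczmarz iterates with data `e`. With `ρ = 1 - 1/r`,
one has `E[w ⬝ z_{s+1}] = ρ E[w ⬝ z_s]` for any `w` that depends only on indices before time `s`, and
`E‖z_{s+1}‖² ≤ ρ E‖z_s‖² + ‖e‖² / r`, hence `E‖z_s‖² ≤ ρ^s ‖z_0‖² + ‖e‖²`.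

*Averaging.* Let `Z_T` be the sum of the `T` iterates from time `tb` on, and `D = ρ^tb ‖z_0‖²`.
Inductions on `T` give `E[Z_T ⬝ z_{tb+T}] ≤ (r - 1) ‖e‖² + T D` and then
`E‖Z_T‖² ≤ T (2r - 1) ‖e‖² + T² D` (`integral_rkPartialSum_sq_le`), with no double sum over pairs of
iterates. These bounds hold for each fixed `S`; independence of `S` from the row indices allows
averaging over `S` at the end (`integral_residualSq_precondTark_le`).
-/

/-! ### The Cauchy–Binet formula -/

/-- Expansion of the determinant of a product of rectangular matrices over all choices of rows;
this is multilinearity of the determinant. -/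
theorem det_mul_eq_sum_fun {n r : ℕ} (M : Matrix (Fin r) (Fin n) ℝ)
    (N : Matrix (Fin n) (Fin r) ℝ) :
    (M * N).det = ∑ p : Fin r → Fin n, (M.submatrix id p).det * ∏ k, N (p k) k := by
  simp only [Matrix.det_apply', Matrix.mul_apply, Finset.prod_univ_sum, Finset.mul_sum,
    Fintype.piFinset_univ, Finset.sum_mul]
  rw [Finset.sum_comm]
  refine Finset.sum_congr rfl fun p _ => Finset.sum_congr rfl fun σ _ => ?_
  rw [Finset.prod_mul_distrib, mul_assoc]
  rfl

/-- An injective choice of rows is a row subset together with a permutation. -/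
theorem exists_orderEmbOfFin_comp_perm {n r : ℕ} (p : Fin r → Fin n)
    (hp : Function.Injective p) :
    ∃ (S : RowSubset n r) (σ : Equiv.Perm (Fin r)), ∀ k, S.1.orderEmbOfFin S.2 (σ k) = p k := by
  have hcard : (Finset.univ.image p).card = r := by
    rw [Finset.card_image_of_injective _ hp, Finset.card_fin]
  have hmem : ∀ k, p k ∈ Set.range ((Finset.univ.image p).orderEmbOfFin hcard) := fun k => by
    rw [Finset.range_orderEmbOfFin]; simp
  choose σ hσ using hmem
  have hσi : Function.Injective σ := fun a c hac => hp (by rw [← hσ a, ← hσ c, hac])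
  exact ⟨⟨_, hcard⟩, Equiv.ofBijective σ (Finite.injective_iff_bijective.1 hσi), hσ⟩

theorem orderEmbOfFin_comp_perm_injective {n r : ℕ} {S S' : RowSubset n r}
    {σ σ' : Equiv.Perm (Fin r)}
    (h : ∀ k, S.1.orderEmbOfFin S.2 (σ k) = S'.1.orderEmbOfFin S'.2 (σ' k)) :
    S = S' ∧ σ = σ' := by
  have hr : ∀ (S : RowSubset n r) (σ : Equiv.Perm (Fin r)),
      Set.range (fun k => S.1.orderEmbOfFin S.2 (σ k)) = S.1 := fun S σ => by
    rw [← Finset.range_orderEmbOfFin S.1 S.2]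
    exact σ.surjective.range_comp _
  have hS : S = S' := Subtype.ext (Finset.coe_injective (by
    rw [← hr S σ, ← hr S' σ', funext h]))
  subst hS
  exact ⟨rfl, Equiv.ext fun k => (S.1.orderEmbOfFin S.2).injective (h k)⟩

/-- The Cauchy–Binet formula for a Gram determinant. -/
theorem det_transpose_mul_self_eq_sum {n r : ℕ} (N : Matrix (Fin n) (Fin r) ℝ) :
    (Nᵀ * N).det = ∑ S : RowSubset n r, (rowSubmatrix N S).det ^ 2 := by
  classical
  rw [det_mul_eq_sum_fun]
  -- Choices that repeat a row contribute nothing.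
  have h1 : ∑ p : Fin r → Fin n, (Nᵀ.submatrix id p).det * ∏ k, N (p k) k =
      ∑ p : Fin r → Fin n with Function.Injective p,
        (Nᵀ.submatrix id p).det * ∏ k, N (p k) k := by
    refine (Finset.sum_subset (Finset.filter_subset _ _) fun p _ hp => ?_).symm
    rw [Finset.mem_filter_univ, Function.Injective] at hp
    push Not at hp
    obtain ⟨a, c, hac, hne⟩ := hp
    rw [Matrix.det_zero_of_column_eq hne (fun k => by simp [hac]), zero_mul]
  have h2 : ∑ p : Fin r → Fin n with Function.Injective p,
        (Nᵀ.submatrix id p).det * ∏ k, N (p k) k =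
      ∑ x : RowSubset n r × Equiv.Perm (Fin r), (rowSubmatrix N x.1).det *
        ((Equiv.Perm.sign x.2 : ℤ) * ∏ k, rowSubmatrix N x.1 (x.2 k) k) := by
    symm
    refine Finset.sum_bij (fun x _ k => x.1.1.orderEmbOfFin x.1.2 (x.2 k)) ?_ ?_ ?_ ?_
    · intro x _
      rw [Finset.mem_filter_univ]
      exact (x.1.1.orderEmbOfFin x.1.2).injective.comp x.2.injective
    · intro x _ x' _ h
      obtain ⟨h1, h2⟩ := orderEmbOfFin_comp_perm_injective (congrFun h)
      exact Prod.ext h1 h2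
    · intro p hp
      obtain ⟨S, σ, h⟩ := exists_orderEmbOfFin_comp_perm p ((Finset.mem_filter_univ p).1 hp)
      exact ⟨(S, σ), Finset.mem_univ _, funext h⟩
    · intro x _
      have hdet : (Nᵀ.submatrix id fun k => x.1.1.orderEmbOfFin x.1.2 (x.2 k)).det =
          (Equiv.Perm.sign x.2 : ℤ) * (rowSubmatrix N x.1).det := by
        rw [← Matrix.det_permute, ← Matrix.det_transpose]
        rfl
      rw [hdet]
      simp only [rowSubmatrix, Matrix.submatrix_apply, id]
      ring
  rw [h1, h2, Fintype.sum_prod_type]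
  refine Finset.sum_congr rfl fun S _ => ?_
  rw [sq]
  conv_rhs => arg 2; rw [Matrix.det_apply']
  exact (Finset.mul_sum Finset.univ (fun σ : Equiv.Perm (Fin r) =>
    ((Equiv.Perm.sign σ : ℤ) : ℝ) * ∏ k, rowSubmatrix N S (σ k) k) (rowSubmatrix N S).det).symm

/-! ### The volume-sampled initial estimate -/

theorem sum_det_rowSubmatrix_sq {n r : ℕ} {Q : Matrix (Fin n) (Fin r) ℝ} (hQ : Qᵀ * Q = 1) :
    ∑ S : RowSubset n r, (rowSubmatrix Q S).det ^ 2 = 1 := by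
  rw [← det_transpose_mul_self_eq_sum, hQ, Matrix.det_one]

theorem volumeProb_eq {n r : ℕ} {Q : Matrix (Fin n) (Fin r) ℝ} (hQ : Qᵀ * Q = 1)
    (S : RowSubset n r) : volumeProb Q S = (rowSubmatrix Q S).det ^ 2 := by
  rw [volumeProb, sum_det_rowSubmatrix_sq hQ, div_one]

/-- Replacing one column of a matrix with orthonormal columns by a vector `e` orthogonal to all of
them leaves the columns orthogonal, so the Gram determinant becomes `‖e‖²`. -/
theorem det_gram_updateCol {n r : ℕ} {Q : Matrix (Fin n) (Fin r) ℝ} (hQ : Qᵀ * Q = 1)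
    {e : Fin n → ℝ} (he : Qᵀ *ᵥ e = 0) (j : Fin r) :
    ((Q.updateCol j e)ᵀ * Q.updateCol j e).det = e ⬝ᵥ e := by
  have hQ' : ∀ a c, ∑ k, Q k a * Q k c = (1 : Matrix (Fin r) (Fin r) ℝ) a c := fun a c => by
    rw [← hQ]; rfl
  have he' : ∀ a, ∑ k, Q k a * e k = 0 := fun a => congrFun he a
  have : (Q.updateCol j e)ᵀ * Q.updateCol j e =
      Matrix.diagonal (Function.update (fun _ => (1 : ℝ)) j (e ⬝ᵥ e)) := by
    ext a c
    rw [Matrix.mul_apply]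
    simp only [Matrix.transpose_apply, Matrix.updateCol_apply, Matrix.diagonal_apply,
      Function.update_apply]
    by_cases ha : a = j <;> by_cases hc : c = j
    · simp [ha, hc, dotProduct]
    · simp only [ha, hc, if_true, if_false, Ne.symm hc]
      simpa only [mul_comm] using he' c
    · simp only [ha, hc, if_true, if_false]
      exact he' a
    · simp only [ha, hc, if_false]
      rw [hQ' a c, Matrix.one_apply]
  rw [this, Matrix.det_diagonal, Finset.prod_update_of_mem (Finset.mem_univ j)]
  simp

/-- Cramer's rule turns the weighted error `det(Q_S)² ‖Q_S⁻¹ e_S‖²` into a sum of squared minors.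
It is an inequality because the left side vanishes when `Q_S` is singular. -/
theorem det_sq_mul_volumeInit_le {n r : ℕ} (Q : Matrix (Fin n) (Fin r) ℝ) (e : Fin n → ℝ)
    (S : RowSubset n r) :
    (rowSubmatrix Q S).det ^ 2 * (volumeInit Q e S ⬝ᵥ volumeInit Q e S) ≤
      ∑ j, (rowSubmatrix (Q.updateCol j e) S).det ^ 2 := by
  by_cases h : (rowSubmatrix Q S).det = 0
  · rw [h, zero_pow two_ne_zero, zero_mul]
    positivity
  · refine le_of_eq ?_
    have h1 : (rowSubmatrix Q S).det • volumeInit Q e S =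
        (rowSubmatrix Q S).cramer fun k => e (S.1.orderEmbOfFin S.2 k) :=
      Matrix.det_smul_inv_mulVec_eq_cramer _ _ (isUnit_iff_ne_zero.2 h)
    rw [dotProduct, Finset.mul_sum]
    refine Finset.sum_congr rfl fun j _ => ?_
    have h2 := congrFun h1 j
    rw [Pi.smul_apply, smul_eq_mul, Matrix.cramer_apply] at h2
    have h3 : rowSubmatrix (Q.updateCol j e) S =
        (rowSubmatrix Q S).updateCol j fun k => e (S.1.orderEmbOfFin S.2 k) := by
      ext a c
      simp [rowSubmatrix, Matrix.updateCol_apply]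
    rw [h3, ← h2]
    ring

theorem sum_volumeProb_mul_volumeInit_le {n r : ℕ} {Q : Matrix (Fin n) (Fin r) ℝ}
    (hQ : Qᵀ * Q = 1) {e : Fin n → ℝ} (he : Qᵀ *ᵥ e = 0) :
    ∑ S : RowSubset n r, volumeProb Q S * (volumeInit Q e S ⬝ᵥ volumeInit Q e S) ≤
      r * (e ⬝ᵥ e) := by
  calc _ ≤ ∑ S : RowSubset n r, ∑ j, (rowSubmatrix (Q.updateCol j e) S).det ^ 2 :=
        Finset.sum_le_sum fun S _ => by
          rw [volumeProb_eq hQ]; exact det_sq_mul_volumeInit_le Q e S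
    _ = r * (e ⬝ᵥ e) := by
        rw [Finset.sum_comm]
        simp_rw [← det_transpose_mul_self_eq_sum, det_gram_updateCol hQ he]
        simp

/-- On a row subset of positive probability, the initial estimate shifts with the target. -/
theorem volumeInit_sub_mulVec {n r : ℕ} {Q : Matrix (Fin n) (Fin r) ℝ} {S : RowSubset n r}
    (hS : (rowSubmatrix Q S).det ≠ 0) (b : Fin n → ℝ) (x : Fin r → ℝ) :
    volumeInit Q (b - Q *ᵥ x) S = volumeInit Q b S - x := by
  have h : (fun k => (b - Q *ᵥ x) (S.1.orderEmbOfFin S.2 k)) =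
      (fun k => b (S.1.orderEmbOfFin S.2 k)) - rowSubmatrix Q S *ᵥ x := rfl
  rw [volumeInit, h, Matrix.mulVec_sub, Matrix.mulVec_mulVec,
    Matrix.nonsing_inv_mul _ (isUnit_iff_ne_zero.2 hS), Matrix.one_mulVec]
  rfl

/-! ### Reduction to the coordinates of the orthonormal factor -/

theorem residualSq_eq_dotProduct {n d : ℕ} (A : Matrix (Fin n) (Fin d) ℝ) (b : Fin n → ℝ)
    (x : Fin d → ℝ) : residualSq A b x = (b - A *ᵥ x) ⬝ᵥ (b - A *ᵥ x) := by
  rw [residualSq, EuclideanSpace.norm_sq_eq]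
  simp [dotProduct, sq]

/-- In a thin QR decomposition of a matrix of rank `r`, the factor `R` has full row rank, so its
pseudoinverse is a right inverse. -/
theorem IsThinQR.mul_pinv_eq_one {n d r : ℕ} {A : Matrix (Fin n) (Fin d) ℝ}
    {Q : Matrix (Fin n) (Fin r) ℝ} {R : Matrix (Fin r) (Fin d) ℝ} (h : IsThinQR A Q R)
    (hA : A.rank = r) : R * pinv R = 1 := by
  have hR : R.rank = r := le_antisymm (by simpa using R.rank_le_height) (hA.ge.trans (by
    rw [h.eq_mul]; exact Matrix.rank_mul_le_right Q R))
  have hsurj : Function.Surjective R.mulVec := by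
    have : LinearMap.range R.mulVecLin = ⊤ := Submodule.eq_top_of_finrank_eq (by
      rw [← Matrix.rank, hR]; simp)
    exact LinearMap.range_eq_top.1 this
  obtain ⟨B, hB⟩ := Matrix.mulVec_surjective_iff_exists_right_inverse.1 hsurj
  calc R * pinv R = R * pinv R * (R * B) := by rw [hB, Matrix.mul_one]
    _ = R * B := by rw [← Matrix.mul_assoc, (isMoorePenrose_pinv R).mul_mul_self]
    _ = 1 := hB

/-- `A A⁺` and `Q Qᵀ` are both the orthogonal projection onto the column space of `A`. -/
theorem IsThinQR.mul_pinv_eq {n d r : ℕ} {A : Matrix (Fin n) (Fin d) ℝ}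
    {Q : Matrix (Fin n) (Fin r) ℝ} {R : Matrix (Fin r) (Fin d) ℝ} (h : IsThinQR A Q R)
    (hA : A.rank = r) : A * pinv A = Q * Qᵀ := by
  have hR := h.mul_pinv_eq_one hA
  have hP := isMoorePenrose_pinv A
  have hPQ : A * pinv A * Q = Q := by
    have h1 : A * pinv A * (Q * R) = Q * R := by rw [← h.eq_mul, hP.mul_mul_self]
    have h2 := congrArg (· * pinv R) h1
    simpa only [Matrix.mul_assoc, hR, Matrix.mul_one] using h2
  have hQP : Qᵀ * (A * pinv A) = Qᵀ := by
    rw [← hP.symm_left, ← Matrix.transpose_mul, hPQ]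
  calc A * pinv A = Q * (Qᵀ * Q) * R * pinv A := by
        rw [h.orthonormal, Matrix.mul_one, ← h.eq_mul]
    _ = Q * (Qᵀ * (Q * R * pinv A)) := by simp only [Matrix.mul_assoc]
    _ = Q * Qᵀ := by rw [← h.eq_mul, hQP]

theorem transpose_mulVec_sub_mulVec {n r : ℕ} {Q : Matrix (Fin n) (Fin r) ℝ} (hQ : Qᵀ * Q = 1)
    (b : Fin n → ℝ) : Qᵀ *ᵥ (b - Q *ᵥ (Qᵀ *ᵥ b)) = 0 := by
  rw [Matrix.mulVec_sub, Matrix.mulVec_mulVec, hQ, Matrix.one_mulVec, sub_self]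

theorem mulVec_dotProduct_mulVec {n r : ℕ} {Q : Matrix (Fin n) (Fin r) ℝ} (hQ : Qᵀ * Q = 1)
    (x y : Fin r → ℝ) : (Q *ᵥ x) ⬝ᵥ (Q *ᵥ y) = x ⬝ᵥ y := by
  rw [Matrix.dotProduct_mulVec, ← Matrix.mulVec_transpose, Matrix.mulVec_mulVec, hQ,
    Matrix.one_mulVec]

theorem dotProduct_mulVec_eq_zero {n r : ℕ} {Q : Matrix (Fin n) (Fin r) ℝ} {e : Fin n → ℝ}
    (he : Qᵀ *ᵥ e = 0) (x : Fin r → ℝ) : e ⬝ᵥ (Q *ᵥ x) = 0 := by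
  rw [Matrix.dotProduct_mulVec, ← Matrix.mulVec_transpose, he, zero_dotProduct]

theorem IsThinQR.residualSq_pinv {n d r : ℕ} {A : Matrix (Fin n) (Fin d) ℝ}
    {Q : Matrix (Fin n) (Fin r) ℝ} {R : Matrix (Fin r) (Fin d) ℝ} (h : IsThinQR A Q R)
    (hA : A.rank = r) (b : Fin n → ℝ) :
    residualSq A b (pinv A *ᵥ b) =
      (b - Q *ᵥ (Qᵀ *ᵥ b)) ⬝ᵥ (b - Q *ᵥ (Qᵀ *ᵥ b)) := by
  rw [residualSq_eq_dotProduct, Matrix.mulVec_mulVec, h.mul_pinv_eq hA, Matrix.mulVec_mulVec]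

/-- Pythagoras: the residual of `R⁺ y` splits into the optimal residual and the error of `y`. -/
theorem IsThinQR.residualSq_pinv_mulVec {n d r : ℕ} {A : Matrix (Fin n) (Fin d) ℝ}
    {Q : Matrix (Fin n) (Fin r) ℝ} {R : Matrix (Fin r) (Fin d) ℝ} (h : IsThinQR A Q R)
    (hA : A.rank = r) (b : Fin n → ℝ) (y : Fin r → ℝ) :
    residualSq A b (pinv R *ᵥ y) = residualSq A b (pinv A *ᵥ b) +
      (y - Qᵀ *ᵥ b) ⬝ᵥ (y - Qᵀ *ᵥ b) := by
  have hy : A *ᵥ (pinv R *ᵥ y) = Q *ᵥ y := by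
    rw [Matrix.mulVec_mulVec, h.eq_mul, Matrix.mul_assoc, h.mul_pinv_eq_one hA, Matrix.mul_one]
  rw [h.residualSq_pinv hA, residualSq_eq_dotProduct, hy]
  have hsplit : b - Q *ᵥ y = (b - Q *ᵥ (Qᵀ *ᵥ b)) - Q *ᵥ (y - Qᵀ *ᵥ b) := by
    rw [Matrix.mulVec_sub]; abel
  have horth := dotProduct_mulVec_eq_zero (transpose_mulVec_sub_mulVec h.orthonormal b)
    (y - Qᵀ *ᵥ b)
  rw [hsplit]
  generalize b - Q *ᵥ (Qᵀ *ᵥ b) = e at horth ⊢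
  rw [sub_dotProduct, dotProduct_sub, dotProduct_sub, dotProduct_comm (Q *ᵥ _) e, horth,
    mulVec_dotProduct_mulVec h.orthonormal]
  ring

/-! ### One Kaczmarz step in expectation -/

theorem rowNormSq_eq_dotProduct {n d : ℕ} (A : Matrix (Fin n) (Fin d) ℝ) (k : Fin n) :
    rowNormSq A k = A k ⬝ᵥ A k := by
  simp [rowNormSq, dotProduct, sq]

theorem sum_rowNormSq {n r : ℕ} {Q : Matrix (Fin n) (Fin r) ℝ} (hQ : Qᵀ * Q = 1) :
    ∑ k, rowNormSq Q k = r := by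
  have h : ∀ j, ∑ k, Q k j ^ 2 = 1 := fun j => by
    have := congrFun (congrFun hQ j) j
    rw [Matrix.mul_apply, Matrix.one_apply_eq] at this
    simpa only [Matrix.transpose_apply, ← sq] using this
  simp only [rowNormSq]
  rw [Finset.sum_comm]
  simp [h]

theorem rowProb_eq {n r : ℕ} {Q : Matrix (Fin n) (Fin r) ℝ} (hQ : Qᵀ * Q = 1) (k : Fin n) :
    rowProb Q k = rowNormSq Q k / r := by
  rw [rowProb, sum_rowNormSq hQ]

theorem sum_rowProb {n r : ℕ} (hr : 0 < r) {Q : Matrix (Fin n) (Fin r) ℝ} (hQ : Qᵀ * Q = 1) :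
    ∑ k, rowProb Q k = 1 := by
  simp_rw [rowProb_eq hQ]
  rw [← Finset.sum_div, sum_rowNormSq hQ, div_self (by positivity)]

theorem row_eq_zero {n d : ℕ} {A : Matrix (Fin n) (Fin d) ℝ} {k : Fin n}
    (h : rowNormSq A k = 0) : A k = 0 := by
  rw [rowNormSq_eq_dotProduct] at h
  exact dotProduct_self_eq_zero.1 h

/-- When the noise `e` is orthogonal to the columns of `Q`, a Kaczmarz step contracts the expected
error by the factor `1 - 1/r`. -/
theorem sum_rowProb_mul_dotProduct_rkStep {n r : ℕ} (hr : 0 < r) {Q : Matrix (Fin n) (Fin r) ℝ}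
    (hQ : Qᵀ * Q = 1) {e : Fin n → ℝ} (he : Qᵀ *ᵥ e = 0) (w z : Fin r → ℝ) :
    ∑ k, rowProb Q k * (w ⬝ᵥ rkStep Q e z k) = (1 - 1 / (r : ℝ)) * (w ⬝ᵥ z) := by
  have hterm : ∀ k, rowProb Q k * (w ⬝ᵥ rkStep Q e z k) = rowProb Q k * (w ⬝ᵥ z) +
      (1 / (r : ℝ)) * (e k * (Q *ᵥ w) k - (Q *ᵥ w) k * (Q *ᵥ z) k) := fun k => by
    have hz : Q k ⬝ᵥ z = (Q *ᵥ z) k := rfl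
    have hw : w ⬝ᵥ Q k = (Q *ᵥ w) k := dotProduct_comm _ _
    rw [rowProb_eq hQ, rkStep, dotProduct_add, dotProduct_smul, smul_eq_mul, hz, hw]
    by_cases hk : rowNormSq Q k = 0
    · have : (Q *ᵥ w) k = 0 := by rw [← hw, row_eq_zero hk, dotProduct_zero]
      simp [hk, this]
    · field_simp
  simp_rw [hterm]
  have h1 : ∑ k, e k * (Q *ᵥ w) k = 0 := dotProduct_mulVec_eq_zero he w
  have h2 : ∑ k, (Q *ᵥ w) k * (Q *ᵥ z) k = w ⬝ᵥ z := mulVec_dotProduct_mulVec hQ w z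
  rw [Finset.sum_add_distrib, ← Finset.sum_mul, sum_rowProb hr hQ, ← Finset.mul_sum,
    Finset.sum_sub_distrib, h1, h2]
  ring

/-- The mean squared error after one step. It is an inequality because the noise on vanishing rows
is never seen. -/
theorem sum_rowProb_mul_rkStep_sq_le {n r : ℕ} (hr : 0 < r) {Q : Matrix (Fin n) (Fin r) ℝ}
    (hQ : Qᵀ * Q = 1) (e : Fin n → ℝ) (z : Fin r → ℝ) :
    ∑ k, rowProb Q k * (rkStep Q e z k ⬝ᵥ rkStep Q e z k) ≤
      (1 - 1 / (r : ℝ)) * (z ⬝ᵥ z) + 1 / (r : ℝ) * (e ⬝ᵥ e) := by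
  have hterm : ∀ k, rowProb Q k * (rkStep Q e z k ⬝ᵥ rkStep Q e z k) ≤ rowProb Q k * (z ⬝ᵥ z) +
      (1 / (r : ℝ)) * (e k * e k - (Q *ᵥ z) k * (Q *ᵥ z) k) := fun k => by
    have hz : Q k ⬝ᵥ z = (Q *ᵥ z) k := rfl
    have hz' : z ⬝ᵥ Q k = (Q *ᵥ z) k := dotProduct_comm _ _
    rw [rowProb_eq hQ, rkStep, add_dotProduct, dotProduct_add, dotProduct_add, smul_dotProduct,
      dotProduct_smul, smul_dotProduct, dotProduct_smul, ← rowNormSq_eq_dotProduct, hz, hz']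
    simp only [smul_eq_mul]
    by_cases hk : rowNormSq Q k = 0
    · have : (Q *ᵥ z) k = 0 := by rw [← hz, row_eq_zero hk, zero_dotProduct]
      simp only [hk, this, zero_div, zero_mul, mul_zero, sub_zero, zero_add]
      exact mul_nonneg (by positivity) (mul_self_nonneg _)
    · refine le_of_eq ?_
      field_simp
      ring
  refine (Finset.sum_le_sum fun k _ => hterm k).trans (le_of_eq ?_)
  have h1 : ∑ k, e k * e k = e ⬝ᵥ e := rfl
  have h2 : ∑ k, (Q *ᵥ z) k * (Q *ᵥ z) k = z ⬝ᵥ z := mulVec_dotProduct_mulVec hQ z z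
  rw [Finset.sum_add_distrib, ← Finset.sum_mul, sum_rowProb hr hQ, ← Finset.mul_sum,
    Finset.sum_sub_distrib, h1, h2]
  ring

/-! ### Which random choices and data the iterates depend on -/

theorem rkIterate_dependsOn {n d : ℕ} (A : Matrix (Fin n) (Fin d) ℝ) (b : Fin n → ℝ)
    (x₀ : Fin d → ℝ) (s : ℕ) :
    DependsOn (fun i : ℕ → Fin n => rkIterate A b x₀ i s) (Finset.range s) := by
  induction s with
  | zero => exact fun _ _ _ => rfl
  | succ s ih =>
    intro i i' h
    have h1 : rkIterate A b x₀ i s = rkIterate A b x₀ i' s :=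
      ih fun k hk => h k (by simp only [Finset.coe_range, Set.mem_Iio] at hk ⊢; omega)
    have h2 : i s = i' s := h s (by simp)
    simp only [rkIterate, h1, h2]

/-- The Kaczmarz iteration commutes with translating the unknown by `c`. -/
theorem rkIterate_sub {n d : ℕ} (A : Matrix (Fin n) (Fin d) ℝ) (b : Fin n → ℝ)
    (x₀ c : Fin d → ℝ) (i : ℕ → Fin n) (s : ℕ) :
    rkIterate A b x₀ i s - c = rkIterate A (b - A *ᵥ c) (x₀ - c) i s := by
  induction s with
  | zero => rfl
  | succ s ih =>
    have h : b (i s) - A (i s) ⬝ᵥ rkIterate A b x₀ i s =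
        (b - A *ᵥ c) (i s) - A (i s) ⬝ᵥ (rkIterate A b x₀ i s - c) := by
      have hc : (A *ᵥ c) (i s) = A (i s) ⬝ᵥ c := rfl
      rw [dotProduct_sub, Pi.sub_apply, hc]
      ring
    rw [rkIterate, rkIterate, rkStep, rkStep, ← ih, h]
    abel

theorem rkIterate_congr_data {n d : ℕ} (A : Matrix (Fin n) (Fin d) ℝ) {b b' : Fin n → ℝ}
    (x₀ : Fin d → ℝ) (i : ℕ → Fin n) (s : ℕ) (h : ∀ j < s, b (i j) = b' (i j)) :
    rkIterate A b x₀ i s = rkIterate A b' x₀ i s := by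
  induction s with
  | zero => rfl
  | succ s ih =>
    rw [rkIterate, rkIterate, rkStep, rkStep, ih fun j hj => h j (by omega), h s (by omega)]

/-! ### Expectations of functions of independent discrete variables -/

section Independence

variable {Ω : Type*} [MeasurableSpace Ω] {μ : Measure Ω}

/-- Fubini for a pair of independent variables, the second of which is finite-valued. -/
theorem integral_comp_of_indepFun_fintype {α β : Type*} [MeasurableSpace α] [MeasurableSpace β]
    [Fintype β] [MeasurableSingletonClass β] {X : Ω → α} {Y : Ω → β} (hX : Measurable X)
    (hY : Measurable Y) (hXY : IndepFun X Y μ) {h : α → β → ℝ}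
    (hm : ∀ k, Measurable fun x => h x k) (hi : ∀ k, Integrable (fun ω => h (X ω) k) μ) :
    Integrable (fun ω => h (X ω) (Y ω)) μ ∧
      ∫ ω, h (X ω) (Y ω) ∂μ = ∑ k, μ.real (Y ⁻¹' {k}) * ∫ ω, h (X ω) k ∂μ := by
  classical
  have hsplit : (fun ω => h (X ω) (Y ω)) =
      fun ω => ∑ k, (Y ⁻¹' {k}).indicator (fun ω => h (X ω) k) ω := by
    funext ω
    rw [Finset.sum_eq_single (Y ω)]
    · simp
    · intro k _ hk
      exact Set.indicator_of_notMem (fun hmem => hk hmem.symm) _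
    · simp
  have hmeas : ∀ k, MeasurableSet (Y ⁻¹' {k}) := fun k => hY (measurableSet_singleton k)
  have hint : ∀ k, Integrable ((Y ⁻¹' {k}).indicator fun ω => h (X ω) k) μ :=
    fun k => (hi k).indicator (hmeas k)
  rw [hsplit]
  refine ⟨integrable_finsetSum _ fun k _ => hint k, ?_⟩
  rw [integral_finsetSum _ fun k _ => hint k]
  refine Finset.sum_congr rfl fun k _ => ?_
  have hg : Measurable (({k} : Set β).indicator (1 : β → ℝ)) :=
    measurable_one.indicator (measurableSet_singleton k)
  have hmul : ((Y ⁻¹' {k}).indicator fun ω => h (X ω) k) =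
      fun ω => ({k} : Set β).indicator (1 : β → ℝ) (Y ω) * h (X ω) k := by
    funext ω
    by_cases hω : Y ω = k <;> simp [Set.indicator, hω]
  have hind : IndepFun (fun ω => ({k} : Set β).indicator (1 : β → ℝ) (Y ω))
      (fun ω => h (X ω) k) μ := hXY.symm.comp hg (hm k)
  rw [hmul, hind.integral_fun_mul_eq_mul_integral (hg.comp hY).aestronglyMeasurable
    ((hm k).comp hX).aestronglyMeasurable]
  congr 1
  exact integral_indicator_one (hmeas k)

theorem measurable_of_dependsOn {n : ℕ} {F : (ℕ → Fin n) → ℝ} {s : ℕ}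
    (hF : DependsOn F (Finset.range s)) : Measurable F := by
  obtain ⟨g, rfl⟩ := dependsOn_iff_exists_comp.1 hF
  exact (measurable_of_finite g).comp
    (measurable_pi_lambda _ fun _ => measurable_pi_apply _)

variable [IsProbabilityMeasure μ] {n : ℕ} {i : ℕ → Ω → Fin n}

/-- A function of finitely many of the indices takes finitely many values. -/
theorem integrable_of_dependsOn (hi : ∀ s, Measurable (i s)) {F : (ℕ → Fin n) → ℝ} {s : ℕ}
    (hF : DependsOn F (Finset.range s)) : Integrable (fun ω => F fun s => i s ω) μ := by
  obtain ⟨g, rfl⟩ := dependsOn_iff_exists_comp.1 hF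
  have hX : Measurable fun ω => (Finset.range s : Set ℕ).domRestrict fun s => i s ω :=
    measurable_pi_lambda _ fun j => hi j
  have : IsFiniteMeasure (μ.map fun ω => (Finset.range s : Set ℕ).domRestrict fun s => i s ω) :=
    inferInstance
  exact (Integrable.of_finite (f := g)).comp_measurable hX

/-- Averaging over the index `i s`, which is independent of the indices before time `s`. -/
theorem integral_eq_sum_of_dependsOn (hi : ∀ s, Measurable (i s)) (hind : iIndepFun i μ) {s : ℕ}
    {F : (ℕ → Fin n) → Fin n → ℝ} (hF : ∀ k, DependsOn (fun x => F x k) (Finset.range s)) :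
    ∫ ω, F (fun s => i s ω) (i s ω) ∂μ =
      ∫ ω, ∑ k, μ.real (i s ⁻¹' {k}) * F (fun s => i s ω) k ∂μ := by
  have hF' : ∀ k, ∃ g, (fun x => F x k) = g ∘ (Finset.range s : Set ℕ).domRestrict := fun k =>
    dependsOn_iff_exists_comp.1 (hF k)
  choose g hg using hF'
  have hg' : ∀ x k, F x k = g k ((Finset.range s : Set ℕ).domRestrict x) := fun x k =>
    congrFun (hg k) x
  have hX : Measurable fun ω => (Finset.range s : Set ℕ).domRestrict fun s => i s ω :=
    measurable_pi_lambda _ fun j => hi j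
  have hXY : IndepFun (fun ω => (Finset.range s : Set ℕ).domRestrict fun s => i s ω) (i s) μ :=
    (hind.indepFun_finset (Finset.range s) {s} (by simp) hi).comp measurable_id
      (measurable_pi_apply (⟨s, by simp⟩ : ({s} : Finset ℕ)))
  have hint : ∀ k, Integrable
      (fun ω => g k ((Finset.range s : Set ℕ).domRestrict fun s => i s ω)) μ := fun k => by
    simpa only [hg'] using integrable_of_dependsOn (μ := μ) hi (hF k)
  have key := (integral_comp_of_indepFun_fintype (h := fun x k => g k x) hX (hi s) hXY
    (fun k => measurable_of_finite _) hint).2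
  simp only [hg']
  rw [integral_finsetSum _ fun k _ => (hint k).const_mul _]
  simp_rw [integral_const_mul]
  exact key

end Independence

/-! ### Moments of the Kaczmarz iterates -/

theorem real_dotProduct_self_nonneg {m : ℕ} (x : Fin m → ℝ) : 0 ≤ x ⬝ᵥ x :=
  Finset.sum_nonneg fun _ _ => mul_self_nonneg _

section Moments

variable {Ω : Type*} [MeasurableSpace Ω] {μ : Measure Ω} [IsProbabilityMeasure μ]
  {n r : ℕ} {Q : Matrix (Fin n) (Fin r) ℝ} {e : Fin n → ℝ} {i : ℕ → Ω → Fin n}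

theorem one_sub_one_div_nonneg {r : ℕ} (hr : 0 < r) : 0 ≤ 1 - 1 / (r : ℝ) := by
  have : (1 : ℝ) ≤ r := by exact_mod_cast hr
  rw [sub_nonneg, div_le_one (by linarith)]
  exact this

theorem integral_dotProduct_rkIterate_succ (hr : 0 < r) (hQ : Qᵀ * Q = 1) (he : Qᵀ *ᵥ e = 0)
    (hi : ∀ s, Measurable (i s)) (hind : iIndepFun i μ)
    (hlaw : ∀ s k, μ.real (i s ⁻¹' {k}) = rowProb Q k) (z₀ : Fin r → ℝ) {s : ℕ}
    {G : (ℕ → Fin n) → Fin r → ℝ} (hG : DependsOn G (Finset.range s)) :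
    ∫ ω, G (fun j => i j ω) ⬝ᵥ rkIterate Q e z₀ (fun j => i j ω) (s + 1) ∂μ =
      (1 - 1 / (r : ℝ)) *
        ∫ ω, G (fun j => i j ω) ⬝ᵥ rkIterate Q e z₀ (fun j => i j ω) s ∂μ := by
  have hdep : ∀ k, DependsOn (fun x => G x ⬝ᵥ rkStep Q e (rkIterate Q e z₀ x s) k)
      (Finset.range s) := fun k x y hxy => by
    simp only [hG hxy, rkIterate_dependsOn Q e z₀ s hxy]
  have h := integral_eq_sum_of_dependsOn (μ := μ) hi hind hdep
  simp only [hlaw, sum_rowProb_mul_dotProduct_rkStep hr hQ he] at h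
  rw [integral_const_mul] at h
  exact h

theorem integral_rkIterate_succ_sq_le (hr : 0 < r) (hQ : Qᵀ * Q = 1)
    (hi : ∀ s, Measurable (i s)) (hind : iIndepFun i μ)
    (hlaw : ∀ s k, μ.real (i s ⁻¹' {k}) = rowProb Q k) (z₀ : Fin r → ℝ) (s : ℕ) :
    ∫ ω, rkIterate Q e z₀ (fun j => i j ω) (s + 1) ⬝ᵥ
        rkIterate Q e z₀ (fun j => i j ω) (s + 1) ∂μ ≤
      (1 - 1 / (r : ℝ)) * ∫ ω, rkIterate Q e z₀ (fun j => i j ω) s ⬝ᵥ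
        rkIterate Q e z₀ (fun j => i j ω) s ∂μ + 1 / (r : ℝ) * (e ⬝ᵥ e) := by
  have hdep : ∀ k, DependsOn (fun x => rkStep Q e (rkIterate Q e z₀ x s) k ⬝ᵥ
      rkStep Q e (rkIterate Q e z₀ x s) k) (Finset.range s) := fun k x y hxy => by
    simp only [rkIterate_dependsOn Q e z₀ s hxy]
  have hsq : DependsOn (fun x => rkIterate Q e z₀ x s ⬝ᵥ rkIterate Q e z₀ x s)
      (Finset.range s) := fun x y hxy => by
    simp only [rkIterate_dependsOn Q e z₀ s hxy]
  have h := integral_eq_sum_of_dependsOn (μ := μ) hi hind hdep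
  simp only [hlaw] at h
  have hint : Integrable (fun ω => (1 - 1 / (r : ℝ)) *
      (rkIterate Q e z₀ (fun j => i j ω) s ⬝ᵥ rkIterate Q e z₀ (fun j => i j ω) s)) μ :=
    (integrable_of_dependsOn hi hsq).const_mul _
  calc _ = _ := h
    _ ≤ ∫ ω, ((1 - 1 / (r : ℝ)) * (rkIterate Q e z₀ (fun j => i j ω) s ⬝ᵥ
          rkIterate Q e z₀ (fun j => i j ω) s) + 1 / (r : ℝ) * (e ⬝ᵥ e)) ∂μ := by
        refine integral_mono ?_ (hint.add (integrable_const _)) fun ω =>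
          sum_rowProb_mul_rkStep_sq_le hr hQ e _
        exact integrable_finsetSum _ fun k _ =>
          (integrable_of_dependsOn hi (hdep k)).const_mul _
    _ = _ := by
        rw [integral_add hint (integrable_const _), integral_const_mul, integral_const,
          probReal_univ, one_smul]

/-- The squared error decays geometrically down to the noise level `‖e‖²`. -/
theorem integral_rkIterate_sq_le (hr : 0 < r) (hQ : Qᵀ * Q = 1)
    (hi : ∀ s, Measurable (i s)) (hind : iIndepFun i μ)
    (hlaw : ∀ s k, μ.real (i s ⁻¹' {k}) = rowProb Q k) (z₀ : Fin r → ℝ) (s : ℕ) :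
    ∫ ω, rkIterate Q e z₀ (fun j => i j ω) s ⬝ᵥ rkIterate Q e z₀ (fun j => i j ω) s ∂μ ≤
      (1 - 1 / (r : ℝ)) ^ s * (z₀ ⬝ᵥ z₀) + e ⬝ᵥ e := by
  induction s with
  | zero =>
    simp only [rkIterate, integral_const, probReal_univ, one_smul, pow_zero, one_mul]
    exact le_add_of_nonneg_right (real_dotProduct_self_nonneg e)
  | succ s ih =>
    refine (integral_rkIterate_succ_sq_le hr hQ hi hind hlaw z₀ s).trans ?_
    have := mul_le_mul_of_nonneg_left ih (one_sub_one_div_nonneg hr)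
    rw [pow_succ]
    linarith

/-- Sum of `T` consecutive iterates, starting with the one at time `tb`. -/
noncomputable def rkPartialSum {n r : ℕ} (Q : Matrix (Fin n) (Fin r) ℝ) (e : Fin n → ℝ)
    (z₀ : Fin r → ℝ) (tb T : ℕ) (x : ℕ → Fin n) : Fin r → ℝ :=
  ∑ j ∈ Finset.range T, rkIterate Q e z₀ x (tb + j)

theorem rkPartialSum_succ (z₀ : Fin r → ℝ) (tb T : ℕ) (x : ℕ → Fin n) :
    rkPartialSum Q e z₀ tb (T + 1) x =
      rkPartialSum Q e z₀ tb T x + rkIterate Q e z₀ x (tb + T) :=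
  Finset.sum_range_succ _ _

theorem rkPartialSum_dependsOn (z₀ : Fin r → ℝ) {tb T m : ℕ} (hm : tb + T ≤ m + 1) :
    DependsOn (rkPartialSum Q e z₀ tb T) (Finset.range m) := by
  intro x y hxy
  refine Finset.sum_congr rfl fun j hj => rkIterate_dependsOn Q e z₀ (tb + j) fun k hk => hxy k ?_
  simp only [Finset.coe_range, Set.mem_Iio, Finset.mem_range] at hj hk ⊢
  omega

theorem integral_rkIterate_sq_le_of_le (hr : 0 < r) (hQ : Qᵀ * Q = 1)
    (hi : ∀ s, Measurable (i s)) (hind : iIndepFun i μ)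
    (hlaw : ∀ s k, μ.real (i s ⁻¹' {k}) = rowProb Q k) (z₀ : Fin r → ℝ) (tb T : ℕ) :
    ∫ ω, rkIterate Q e z₀ (fun j => i j ω) (tb + T) ⬝ᵥ
        rkIterate Q e z₀ (fun j => i j ω) (tb + T) ∂μ ≤
      (1 - 1 / (r : ℝ)) ^ tb * (z₀ ⬝ᵥ z₀) + e ⬝ᵥ e := by
  refine (integral_rkIterate_sq_le hr hQ hi hind hlaw z₀ (tb + T)).trans ?_
  refine add_le_add_left (mul_le_mul_of_nonneg_right ?_ (real_dotProduct_self_nonneg z₀)) _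
  exact pow_le_pow_of_le_one (one_sub_one_div_nonneg hr) (by simp) (Nat.le_add_right tb T)

/-- The correlation of the running sum with the next iterate. The noise part stays below
`(r - 1) ‖e‖²`, the fixed point of `c ↦ (1 - 1/r) (c + ‖e‖²)`; the part inherited from the starting
point grows at most linearly in `T`. -/
theorem integral_rkPartialSum_dotProduct_le (hr : 0 < r) (hQ : Qᵀ * Q = 1) (he : Qᵀ *ᵥ e = 0)
    (hi : ∀ s, Measurable (i s)) (hind : iIndepFun i μ)
    (hlaw : ∀ s k, μ.real (i s ⁻¹' {k}) = rowProb Q k) (z₀ : Fin r → ℝ) (tb T : ℕ) :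
    ∫ ω, rkPartialSum Q e z₀ tb T (fun j => i j ω) ⬝ᵥ
        rkIterate Q e z₀ (fun j => i j ω) (tb + T) ∂μ ≤
      ((r : ℝ) - 1) * (e ⬝ᵥ e) + T * ((1 - 1 / (r : ℝ)) ^ tb * (z₀ ⬝ᵥ z₀)) := by
  induction T with
  | zero =>
    have h1 : (1 : ℝ) ≤ r := by exact_mod_cast hr
    simp only [rkPartialSum, Finset.range_zero, Finset.sum_empty, zero_dotProduct, integral_zero,
      Nat.cast_zero, zero_mul, add_zero]
    exact mul_nonneg (by linarith) (real_dotProduct_self_nonneg e)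
  | succ T ih =>
    have hdep : DependsOn (rkPartialSum Q e z₀ tb (T + 1)) (Finset.range (tb + T)) :=
      rkPartialSum_dependsOn z₀ (by omega)
    have hint1 : Integrable (fun ω => rkPartialSum Q e z₀ tb T (fun j => i j ω) ⬝ᵥ
        rkIterate Q e z₀ (fun j => i j ω) (tb + T)) μ :=
      integrable_of_dependsOn (s := tb + T) hi (F := fun x => rkPartialSum Q e z₀ tb T x ⬝ᵥ
        rkIterate Q e z₀ x (tb + T)) fun x y hxy => by
        simp only [rkPartialSum_dependsOn z₀ (Nat.le_succ _) hxy, rkIterate_dependsOn _ _ _ _ hxy]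
    have hint2 : Integrable (fun ω => rkIterate Q e z₀ (fun j => i j ω) (tb + T) ⬝ᵥ
        rkIterate Q e z₀ (fun j => i j ω) (tb + T)) μ :=
      integrable_of_dependsOn (s := tb + T) hi (F := fun x => rkIterate Q e z₀ x (tb + T) ⬝ᵥ
        rkIterate Q e z₀ x (tb + T)) fun x y hxy => by
        simp only [rkIterate_dependsOn _ _ _ _ hxy]
    rw [← add_assoc, integral_dotProduct_rkIterate_succ hr hQ he hi hind hlaw z₀ hdep]
    simp only [rkPartialSum_succ, add_dotProduct]
    rw [integral_add hint1 hint2]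
    have hsq := integral_rkIterate_sq_le_of_le (e := e) hr hQ hi hind hlaw z₀ tb T
    have hρ := one_sub_one_div_nonneg hr
    have hD : 0 ≤ (1 - 1 / (r : ℝ)) ^ tb * (z₀ ⬝ᵥ z₀) :=
      mul_nonneg (pow_nonneg hρ _) (real_dotProduct_self_nonneg z₀)
    refine (mul_le_mul_of_nonneg_left (add_le_add ih hsq) hρ).trans ?_
    generalize (1 - 1 / (r : ℝ)) ^ tb * (z₀ ⬝ᵥ z₀) = D at hD ⊢
    have hr' : (r : ℝ) ≠ 0 := by positivity
    have h1 : (1 - 1 / (r : ℝ)) * (((r : ℝ) - 1) * (e ⬝ᵥ e) + T * D + (D + e ⬝ᵥ e)) =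
        ((r : ℝ) - 1) * (e ⬝ᵥ e) + ((T : ℝ) + 1) * D - 1 / (r : ℝ) * (((T : ℝ) + 1) * D) := by
      field_simp
      ring
    rw [h1, Nat.cast_succ]
    exact sub_le_self _ (by positivity)

/-- The second moment of the running sum, by induction from `integral_rkPartialSum_dotProduct_le`.
Dividing by `T²`, the noise contributes at the rate `1/T` and the starting point only through its
error at time `tb`. -/
theorem integral_rkPartialSum_sq_le (hr : 0 < r) (hQ : Qᵀ * Q = 1) (he : Qᵀ *ᵥ e = 0)
    (hi : ∀ s, Measurable (i s)) (hind : iIndepFun i μ)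
    (hlaw : ∀ s k, μ.real (i s ⁻¹' {k}) = rowProb Q k) (z₀ : Fin r → ℝ) (tb T : ℕ) :
    ∫ ω, rkPartialSum Q e z₀ tb T (fun j => i j ω) ⬝ᵥ
        rkPartialSum Q e z₀ tb T (fun j => i j ω) ∂μ ≤
      T * ((2 * (r : ℝ) - 1) * (e ⬝ᵥ e)) +
        (T : ℝ) ^ 2 * ((1 - 1 / (r : ℝ)) ^ tb * (z₀ ⬝ᵥ z₀)) := by
  induction T with
  | zero => simp [rkPartialSum]
  | succ T ih =>
    have hZ : ∀ {x y : ℕ → Fin n}, (∀ k ∈ (Finset.range (tb + T) : Set ℕ), x k = y k) →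
        rkPartialSum Q e z₀ tb T x = rkPartialSum Q e z₀ tb T y :=
      fun h => rkPartialSum_dependsOn z₀ (Nat.le_succ _) h
    have hz : ∀ {x y : ℕ → Fin n}, (∀ k ∈ (Finset.range (tb + T) : Set ℕ), x k = y k) →
        rkIterate Q e z₀ x (tb + T) = rkIterate Q e z₀ y (tb + T) :=
      fun h => rkIterate_dependsOn Q e z₀ _ h
    have hint0 : Integrable (fun ω => rkPartialSum Q e z₀ tb T (fun j => i j ω) ⬝ᵥ
        rkPartialSum Q e z₀ tb T (fun j => i j ω)) μ :=
      integrable_of_dependsOn (s := tb + T) hi (F := fun x => rkPartialSum Q e z₀ tb T x ⬝ᵥ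
        rkPartialSum Q e z₀ tb T x) fun x y hxy => by simp only [hZ hxy]
    have hint1 : Integrable (fun ω => rkPartialSum Q e z₀ tb T (fun j => i j ω) ⬝ᵥ
        rkIterate Q e z₀ (fun j => i j ω) (tb + T)) μ :=
      integrable_of_dependsOn (s := tb + T) hi (F := fun x => rkPartialSum Q e z₀ tb T x ⬝ᵥ
        rkIterate Q e z₀ x (tb + T)) fun x y hxy => by simp only [hZ hxy, hz hxy]
    have hint2 : Integrable (fun ω => rkIterate Q e z₀ (fun j => i j ω) (tb + T) ⬝ᵥ
        rkIterate Q e z₀ (fun j => i j ω) (tb + T)) μ :=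
      integrable_of_dependsOn (s := tb + T) hi (F := fun x => rkIterate Q e z₀ x (tb + T) ⬝ᵥ
        rkIterate Q e z₀ x (tb + T)) fun x y hxy => by simp only [hz hxy]
    have hexp : ∀ a c : Fin r → ℝ, (a + c) ⬝ᵥ (a + c) = a ⬝ᵥ a + 2 * (a ⬝ᵥ c) + c ⬝ᵥ c :=
      fun a c => by
        rw [add_dotProduct, dotProduct_add, dotProduct_add, dotProduct_comm c a]
        ring
    simp only [rkPartialSum_succ, hexp]
    have hint01 : Integrable (fun ω => rkPartialSum Q e z₀ tb T (fun j => i j ω) ⬝ᵥ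
        rkPartialSum Q e z₀ tb T (fun j => i j ω) + 2 * (rkPartialSum Q e z₀ tb T
        (fun j => i j ω) ⬝ᵥ rkIterate Q e z₀ (fun j => i j ω) (tb + T))) μ :=
      hint0.add (hint1.const_mul 2)
    rw [integral_add hint01 hint2, integral_add hint0 (hint1.const_mul 2), integral_const_mul]
    have hcross := integral_rkPartialSum_dotProduct_le hr hQ he hi hind hlaw z₀ tb T
    have hsq := integral_rkIterate_sq_le_of_le (e := e) hr hQ hi hind hlaw z₀ tb T
    push_cast
    linarith

end Moments

/-! ### The tail average and the mean squared residual -/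

theorem tark_sub {n r : ℕ} (Q : Matrix (Fin n) (Fin r) ℝ) (b : Fin n → ℝ) (x₀ c : Fin r → ℝ)
    {tb t : ℕ} (h : tb < t) (x : ℕ → Fin n) :
    tark Q b x₀ tb t x - c =
      ((t : ℝ) - tb)⁻¹ • rkPartialSum Q (b - Q *ᵥ c) (x₀ - c) tb (t - tb) x := by
  have ht : (t : ℝ) - tb ≠ 0 := by
    have : (tb : ℝ) < t := by exact_mod_cast h
    linarith
  have hc : ((t - tb : ℕ) : ℝ) = (t : ℝ) - tb := Nat.cast_sub h.le
  rw [tark, rkPartialSum, Finset.sum_Ico_eq_sum_range]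
  simp_rw [← rkIterate_sub]
  rw [Finset.sum_sub_distrib, smul_sub, Finset.sum_const, Finset.card_range,
    ← Nat.cast_smul_eq_nsmul ℝ, hc, inv_smul_smul₀ ht]

theorem tark_dependsOn {n r : ℕ} (Q : Matrix (Fin n) (Fin r) ℝ) (b : Fin n → ℝ)
    (x₀ : Fin r → ℝ) (tb t : ℕ) : DependsOn (tark Q b x₀ tb t) (Finset.range t) := by
  intro x y hxy
  rw [tark, tark]
  congr 1
  refine Finset.sum_congr rfl fun s hs => rkIterate_dependsOn Q b x₀ s fun k hk => hxy k ?_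
  simp only [Finset.coe_range, Set.mem_Iio, Finset.mem_Ico] at hs hk ⊢
  omega

/-- The mean squared error of the tail average for a fixed starting point: the bias dies out at the
rate `(1 - 1/r)^tb`, and averaging divides the variance by the number of iterates. -/
theorem integral_tark_sub_sq_le {n r : ℕ} (hr : 0 < r) {Q : Matrix (Fin n) (Fin r) ℝ}
    (hQ : Qᵀ * Q = 1) {Ω : Type*} [MeasurableSpace Ω] {μ : Measure Ω} [IsProbabilityMeasure μ]
    {i : ℕ → Ω → Fin n} (hi : ∀ s, Measurable (i s)) (hind : iIndepFun i μ)
    (hlaw : ∀ s k, μ.real (i s ⁻¹' {k}) = rowProb Q k) (b : Fin n → ℝ) (x₀ c : Fin r → ℝ)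
    (hc : Qᵀ *ᵥ (b - Q *ᵥ c) = 0) {tb t : ℕ} (h : tb < t) :
    ∫ ω, (tark Q b x₀ tb t (fun s => i s ω) - c) ⬝ᵥ (tark Q b x₀ tb t (fun s => i s ω) - c) ∂μ ≤
      (1 - 1 / (r : ℝ)) ^ tb * ((x₀ - c) ⬝ᵥ (x₀ - c)) +
        (2 * (r : ℝ) - 1) / ((t : ℝ) - tb) * ((b - Q *ᵥ c) ⬝ᵥ (b - Q *ᵥ c)) := by
  have ht : 0 < (t : ℝ) - tb := by
    have : (tb : ℝ) < t := by exact_mod_cast h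
    linarith
  have hbound := integral_rkPartialSum_sq_le hr hQ hc hi hind hlaw (x₀ - c) tb (t - tb)
  rw [Nat.cast_sub h.le] at hbound
  simp_rw [tark_sub Q b x₀ c h, smul_dotProduct, dotProduct_smul, smul_eq_mul]
  rw [integral_const_mul, integral_const_mul, ← mul_assoc]
  refine (mul_le_mul_of_nonneg_left hbound (by positivity)).trans (le_of_eq ?_)
  field_simp
  ring

theorem sum_volumeProb {n r : ℕ} {Q : Matrix (Fin n) (Fin r) ℝ} (hQ : Qᵀ * Q = 1) :
    ∑ S : RowSubset n r, volumeProb Q S = 1 := by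
  simp_rw [volumeProb_eq hQ]
  exact sum_det_rowSubmatrix_sq hQ

/-- The mean squared residual, with integrability: the tail-average bound holds for every row
subset, and averaging over volume sampling replaces the initial error by `r ‖b - A x⋆‖²`. -/
theorem integral_residualSq_precondTark_le {n d r : ℕ} (hr : 0 < r)
    {A : Matrix (Fin n) (Fin d) ℝ} (hA : A.rank = r) (b : Fin n → ℝ)
    {Q : Matrix (Fin n) (Fin r) ℝ} {R : Matrix (Fin r) (Fin d) ℝ} (hQR : IsThinQR A Q R)
    {Ω : Type*} [MeasurableSpace Ω] {μ : Measure Ω} [IsProbabilityMeasure μ]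
    {S : Ω → RowSubset n r} {i : ℕ → Ω → Fin n} (hSi : IsPrecondTarkSample Q μ S i)
    {tb t : ℕ} (h : tb < t) :
    Integrable (fun ω => residualSq A b (precondTark Q R b tb t (S ω) (fun s => i s ω))) μ ∧
      ∫ ω, residualSq A b (precondTark Q R b tb t (S ω) (fun s => i s ω)) ∂μ ≤
        (1 + (1 - 1 / (r : ℝ)) ^ tb * (r : ℝ) + (2 * (r : ℝ) - 1) / ((t : ℝ) - (tb : ℝ))) *
          residualSq A b (pinv A *ᵥ b) := by
  have hQ := hQR.orthonormal
  have he := transpose_mulVec_sub_mulVec hQ b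
  simp_rw [precondTark, hQR.residualSq_pinv_mulVec hA]
  rw [hQR.residualSq_pinv hA]
  set c := Qᵀ *ᵥ b
  set e := b - Q *ᵥ c with hedef
  have hdep : ∀ T : RowSubset n r, DependsOn (fun x => e ⬝ᵥ e +
      (tark Q b (volumeInit Q b T) tb t x - c) ⬝ᵥ (tark Q b (volumeInit Q b T) tb t x - c))
      (Finset.range t) := fun T x y hxy => by
    simp only [tark_dependsOn Q b _ tb t hxy]
  have hdep' : ∀ T : RowSubset n r, DependsOn (fun x =>
      (tark Q b (volumeInit Q b T) tb t x - c) ⬝ᵥ (tark Q b (volumeInit Q b T) tb t x - c))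
      (Finset.range t) := fun T x y hxy => by
    simp only [tark_dependsOn Q b _ tb t hxy]
  have key := integral_comp_of_indepFun_fintype (μ := μ)
    (measurable_pi_lambda _ fun s => hSi.measurable_index s) hSi.measurable_subset
    hSi.subset_indep.symm (fun T => measurable_of_dependsOn (hdep T))
    (fun T => integrable_of_dependsOn hSi.measurable_index (hdep T))
  refine ⟨key.1, key.2.trans_le ?_⟩
  simp_rw [hSi.subset_law]
  have hterm : ∀ T : RowSubset n r, volumeProb Q T * ∫ ω, (e ⬝ᵥ e +
      (tark Q b (volumeInit Q b T) tb t (fun s => i s ω) - c) ⬝ᵥ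
        (tark Q b (volumeInit Q b T) tb t (fun s => i s ω) - c)) ∂μ ≤
      volumeProb Q T * (e ⬝ᵥ e + (2 * (r : ℝ) - 1) / ((t : ℝ) - tb) * (e ⬝ᵥ e)) +
        (1 - 1 / (r : ℝ)) ^ tb *
          (volumeProb Q T * (volumeInit Q e T ⬝ᵥ volumeInit Q e T)) := fun T => by
    by_cases hT : (rowSubmatrix Q T).det = 0
    · simp [volumeProb_eq hQ, hT]
    · have hp : 0 ≤ volumeProb Q T := by rw [volumeProb_eq hQ]; positivity
      have hb := integral_tark_sub_sq_le hr hQ hSi.measurable_index hSi.index_indep hSi.index_law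
        b (volumeInit Q b T) c he h
      rw [← volumeInit_sub_mulVec hT, ← hedef] at hb
      rw [integral_add (integrable_const _)
        (integrable_of_dependsOn hSi.measurable_index (hdep' T)), integral_const, probReal_univ,
        one_smul]
      have := mul_le_mul_of_nonneg_left hb hp
      linarith
  refine (Finset.sum_le_sum fun T _ => hterm T).trans ?_
  rw [Finset.sum_add_distrib, ← Finset.sum_mul, sum_volumeProb hQ, ← Finset.mul_sum]
  have := mul_le_mul_of_nonneg_left (sum_volumeProb_mul_volumeInit_le hQ he)
    (pow_nonneg (one_sub_one_div_nonneg hr) tb)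
  linarith

/-! ### Parameter choice and data access -/

theorem bias_add_variance_le {r : ℕ} (hr : 0 < r) {ε : ℝ} (hε : 0 < ε) :
    (1 - 1 / (r : ℝ)) ^ ⌈(r : ℝ) * Real.log (2 * (r : ℝ) / ε)⌉₊ * (r : ℝ) +
      (2 * (r : ℝ) - 1) / (⌈(4 * (r : ℝ) - 2) / ε⌉₊ : ℝ) ≤ ε := by
  have hr1 : (1 : ℝ) ≤ r := by exact_mod_cast hr
  have hr0 : (0 : ℝ) < r := by linarith
  set tb := ⌈(r : ℝ) * Real.log (2 * (r : ℝ) / ε)⌉₊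
  have h1 : (1 - 1 / (r : ℝ)) ^ tb ≤ ε / (2 * r) := by
    calc (1 - 1 / (r : ℝ)) ^ tb ≤ (Real.exp (-(1 / (r : ℝ)))) ^ tb :=
          pow_le_pow_left₀ (one_sub_one_div_nonneg hr) (Real.one_sub_le_exp_neg _) _
      _ = Real.exp (-(tb / (r : ℝ))) := by
          rw [← Real.exp_nat_mul]; congr 1; ring
      _ ≤ Real.exp (-Real.log (2 * (r : ℝ) / ε)) := by
          refine Real.exp_le_exp.2 (neg_le_neg ?_)
          rw [le_div_iff₀ hr0, mul_comm]
          exact Nat.le_ceil _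
      _ = ε / (2 * r) := by
          rw [Real.exp_neg, Real.exp_log (by positivity), inv_div]
  have hpos : 0 < (4 * (r : ℝ) - 2) / ε := div_pos (by linarith) hε
  have h2 : (2 * (r : ℝ) - 1) / (⌈(4 * (r : ℝ) - 2) / ε⌉₊ : ℝ) ≤ ε / 2 := by
    calc _ ≤ (2 * (r : ℝ) - 1) / ((4 * (r : ℝ) - 2) / ε) :=
          div_le_div_of_nonneg_left (by linarith) hpos (Nat.le_ceil _)
      _ = ε / 2 := by
          have : 2 * (r : ℝ) - 1 ≠ 0 := by linarith
          rw [show 4 * (r : ℝ) - 2 = 2 * (2 * r - 1) by ring]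
          field_simp
  have h3 : (1 - 1 / (r : ℝ)) ^ tb * r ≤ ε / 2 := by
    calc _ ≤ ε / (2 * r) * r := mul_le_mul_of_nonneg_right h1 hr0.le
      _ = ε / 2 := by field_simp
  linarith

/-- Two roundings up cost at most one more than a single one; this is the Kaczmarz update that the
last iterate does not need. -/
theorem ceil_add_ceil_le {x y : ℝ} (hx : 0 ≤ x) (hy : 0 ≤ y) : ⌈x⌉₊ + ⌈y⌉₊ ≤ ⌈x + y⌉₊ + 1 := by
  have h1 := Nat.ceil_lt_add_one hx
  have h2 := Nat.ceil_lt_add_one hy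
  have h3 := Nat.le_ceil (x + y)
  have h4 : ((⌈x⌉₊ + ⌈y⌉₊ : ℕ) : ℝ) < ((⌈x + y⌉₊ + 2 : ℕ) : ℝ) := by
    push_cast
    linarith
  have h5 := Nat.cast_lt.1 h4
  omega

theorem card_entriesRead {n r : ℕ} (t : ℕ) (S : RowSubset n r) (i : ℕ → Fin n) :
    (entriesRead t S i).card = r + (t - 1) := by
  rw [entriesRead, Multiset.card_add, Finset.card_val, S.2, Multiset.card_map,
    Multiset.card_range]

theorem precondTark_dependsOn_entriesRead {n d r : ℕ} (Q : Matrix (Fin n) (Fin r) ℝ)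
    (R : Matrix (Fin r) (Fin d) ℝ) (tb t : ℕ) (S : RowSubset n r) (i : ℕ → Fin n) :
    DependsOn (fun b : Fin n → ℝ => precondTark Q R b tb t S i) {k | k ∈ entriesRead t S i} := by
  intro b b' h
  have h1 : volumeInit Q b S = volumeInit Q b' S := by
    rw [volumeInit, volumeInit]
    congr 1
    funext k
    exact h _ (Multiset.mem_add.2 (Or.inl (S.1.orderEmbOfFin_mem S.2 k)))
  have h2 : ∀ j < t - 1, b (i j) = b' (i j) := fun j hj =>
    h _ (Multiset.mem_add.2 (Or.inr (Multiset.mem_map_of_mem i (Multiset.mem_range.2 hj))))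
  simp only [precondTark, tark, h1]
  congr 2
  refine Finset.sum_congr rfl fun s hs => rkIterate_congr_data Q _ i s fun j hj => h2 j ?_
  rw [Finset.mem_Ico] at hs
  omega

theorem mainTheorem6 {n d r : ℕ} (hr : 0 < r)
    (A : Matrix (Fin n) (Fin d) ℝ) (hA : A.rank = r) (b : Fin n → ℝ)
    (Q : Matrix (Fin n) (Fin r) ℝ) (R : Matrix (Fin r) (Fin d) ℝ) (hQR : IsThinQR A Q R)
    {Ω : Type*} [MeasurableSpace Ω] (μ : Measure Ω) [IsProbabilityMeasure μ]
    (S : Ω → RowSubset n r) (i : ℕ → Ω → Fin n) (hSi : IsPrecondTarkSample Q μ S i) :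
    (∀ tb t : ℕ, tb < t →
      Integrable (fun ω => residualSq A b (precondTark Q R b tb t (S ω) (fun s => i s ω))) μ ∧
      ∫ ω, residualSq A b (precondTark Q R b tb t (S ω) (fun s => i s ω)) ∂μ ≤
        (1 + (1 - 1 / (r : ℝ)) ^ tb * (r : ℝ) + (2 * (r : ℝ) - 1) / ((t : ℝ) - (tb : ℝ))) *
          residualSq A b (pinv A *ᵥ b)) ∧
    (∀ ε : ℝ, 0 < ε → ε ≤ 2 * (r : ℝ) → ∀ tb t : ℕ,
      tb = ⌈(r : ℝ) * Real.log (2 * (r : ℝ) / ε)⌉₊ →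
      t = tb + ⌈(4 * (r : ℝ) - 2) / ε⌉₊ →
      tb < t ∧
      ∫ ω, residualSq A b (precondTark Q R b tb t (S ω) (fun s => i s ω)) ∂μ ≤
        (1 + ε) * residualSq A b (pinv A *ᵥ b) ∧
      ∀ ω,
        (entriesRead t (S ω) (fun s => i s ω)).card ≤
          ⌈(r : ℝ) + (r : ℝ) * Real.log (2 * (r : ℝ) / ε) + (4 * (r : ℝ) - 2) / ε⌉₊ ∧
        DependsOn (fun b' : Fin n → ℝ => precondTark Q R b' tb t (S ω) (fun s => i s ω))
          {k | k ∈ entriesRead t (S ω) (fun s => i s ω)}) := by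
  refine ⟨fun tb t h => integral_residualSq_precondTark_le hr hA b hQR hSi h, ?_⟩
  rintro ε hε hε' tb t rfl rfl
  have hr1 : (1 : ℝ) ≤ r := by exact_mod_cast hr
  have hlog : 0 ≤ (r : ℝ) * Real.log (2 * (r : ℝ) / ε) :=
    mul_nonneg (by linarith) (Real.log_nonneg ((one_le_div hε).2 hε'))
  have hpos : 0 < (4 * (r : ℝ) - 2) / ε := div_pos (by linarith) hε
  have hceil : 0 < ⌈(4 * (r : ℝ) - 2) / ε⌉₊ := Nat.ceil_pos.2 hpos
  refine ⟨by omega, ?_, fun ω => ⟨?_, precondTark_dependsOn_entriesRead Q R _ _ _ _⟩⟩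
  · refine (integral_residualSq_precondTark_le hr hA b hQR hSi (by omega)).2.trans ?_
    refine mul_le_mul_of_nonneg_right ?_ (sq_nonneg _)
    have := bias_add_variance_le hr hε
    rw [Nat.cast_add, add_sub_cancel_left]
    linarith
  · rw [card_entriesRead, add_assoc, add_comm (r : ℝ), Nat.ceil_add_natCast (by positivity)]
    have := ceil_add_ceil_le hlog hpos.le
    omega
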